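/- Let $2^\omega$ be the Cantor space and let $\mathcal H(2^\omega)$ be the group of homeomorphisms of $2^\omega$, with the topology generated by the sets $\{f \mid f[U]=V\}$ for $U,V\subseteq 2^\omega$ clopen. Let $\mathbb M\subseteq\mathcal H(2^\omega)$ be the subspace of minimal homeomorphisms, i.e. those $f$ for which every orbit $\{f^i(x)\mid i\in\mathbb Z\}$ is dense. For $f,g\in\mathbb M$, write $(f,g)\in CO$ (conjugacy) if there is $\varphi\in\mathcal H(2^\omega)$ with $\varphi\circ f=g\circ\varphi$, and $(f,g)\in FCO$ (flip-conjugacy) if there is $\varphi\in\mathcal H(2^\omega)$ with $\varphi\circ f=g\circ\varphi$ or $\varphi\circ f=g^{-1}\circ\varphi$. A digraph on $X$ is a relation $R\subseteq X\times X$ disjoint from the diagonal $\Delta(X)$. The continuous chromatic number $\chi_c(X,R)$ of a digraph $R$ on a topological space $X$ is the least cardinal $\kappa\le\aleph_0$ such that there is a continuous map $c:X\to\kappa$, with $\kappa$ discrete, satisfying $c(x)\neq c(y)$ for all $(x,y)\in R$, if such a $\kappa$ exists, and $2^{\aleph_0}$ otherwise. Let $\mathcal K(2^\omega\times 2^\omega)$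 be the space of compact subsets of $2^\omega\times2^\omega$ with the Vietoris topology, and let $$\mathcal S_m=\{(2^\omega,K)\mid K\in\mathcal K(2^\omega\times 2^\omega),\ K\cap\Delta(2^\omega)=\emptyset,\ 2\le\chi_c(2^\omega,K)\le 3\},$$ identified with a subspace of $\mathcal K(2^\omega\times 2^\omega)$. For $(2^\omega,K),(2^\omega,L)\in\mathcal S_m$, write $(2^\omega,K)\preceq^i_c(2^\omega,L)$ if there is an injective continuous $\varphi:2^\omega\to2^\omega$ with $(\varphi(x),\varphi(y))\in L$ for all $(x,y)\in K$, and let $\equiv^i_c$ be $\preceq^i_c\cap(\preceq^i_c)^{-1}$. For $f\in\mathbb M$, let $G_f=\{(x,y)\mid y=f(x)\text{ or }x=f(y)\}\setminus\Delta(2^\omega)$. Then $\mathbb M$ and $\mathcal S_m$ are Polish spaces; $FCO$ and $CO$ are analytic equivalence relations on $\mathbb M$, and $\equiv^i_c$ is an analytic equivalence relation on $\mathcal S_m$ (analytic as subsets of $\mathbb M\times\mathbb M$, resp. $\mathcal S_m\times\mathcal S_m$). Moreover $FCO$ is Borel reducible to $\equiv^i_c$, i.e. there is a Borel map $\psi:\mathbb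 M\to\mathcal S_m$ such that $(f,g)\in FCO\Leftrightarrow\psi(f)\equiv^i_c\psi(g)$ for all $f,g\in\mathbb M$; in fact $f\mapsto(2^\omega,G_f)$ is a well-defined continuous map from $\mathbb M$ to $\mathcal S_m$ with this property. -/

import Mathlib

namespace CantorGraph

open TopologicalSpace Cardinal

/-- The Cantor space `2^ω` with its product topology. -/
abbrev Cantor : Type := ℕ → Bool

section Dynamics

variable {X Y : Type*} [TopologicalSpace X] [TopologicalSpace Y]

/-- The two-sided orbit `{f^i(x) | i ∈ ℤ}` of `x` under a homeomorphism `f` of `X`. -/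
def orbit (f : X ≃ₜ X) (x : X) : Set X := Set.range fun i : ℤ => (f ^ i) x

/-- A homeomorphism is minimal if all its orbits are dense. -/
def IsMinimalHomeo (f : X ≃ₜ X) : Prop := ∀ x, Dense (orbit f x)

/-- `f` and `g` are conjugate: `φ ∘ f = g ∘ φ` for some homeomorphism `φ`. -/
def Conjugate (f : X ≃ₜ X) (g : Y ≃ₜ Y) : Prop :=
  ∃ φ : X ≃ₜ Y, φ ∘ f = g ∘ φ

/-- `f` and `g` are flip-conjugate: `φ ∘ f = g ∘ φ` or `φ ∘ f = g⁻¹ ∘ φ` for some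
homeomorphism `φ`. -/
def FlipConjugate (f : X ≃ₜ X) (g : Y ≃ₜ Y) : Prop :=
  ∃ φ : X ≃ₜ Y, φ ∘ f = g ∘ φ ∨ φ ∘ f = g.symm ∘ φ

end Dynamics

/-- The topology on the group of homeomorphisms of `2^ω` generated by the sets
`{f | f[U] = V}` for `U`, `V` clopen. -/
instance homeoTopology : TopologicalSpace (Cantor ≃ₜ Cantor) :=
  generateFrom {O | ∃ U V : Set Cantor, IsClopen U ∧ IsClopen V ∧ O = {f : Cantor ≃ₜ Cantor | f '' U = V}}

/-- The space `𝕄` of minimal homeomorphisms of `2^ω`, with the subspace topology. -/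
abbrev MinimalHomeo : Type := {f : Cantor ≃ₜ Cantor // IsMinimalHomeo f}

/-- The conjugacy relation on `𝕄`. -/
def CO (f g : MinimalHomeo) : Prop := Conjugate f.1 g.1

/-- The flip-conjugacy relation on `𝕄`. -/
def FCO (f g : MinimalHomeo) : Prop := FlipConjugate f.1 g.1

section Graphs

/-- The graph `G_f` induced by `f`: the symmetrization of `Graph(f)`, minus the diagonal. -/
def inducedGraph {X : Type*} (f : X → X) : Set (X × X) :=
  ({p | p.2 = f p.1} ∪ {p | p.1 = f p.2}) \ Set.diagonal X

variable {X Y : Type} [TopologicalSpace X] [TopologicalSpace Y]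

/-- The relation `R` on `X` has a continuous coloring with values in the cardinal `κ`,
equipped with the discrete topology (for which continuous means locally constant). -/
def HasContinuousColoring (R : Set (X × X)) (κ : Cardinal.{0}) : Prop :=
  ∃ (C : Type) (c : LocallyConstant X C), #C = κ ∧ ∀ p ∈ R, c p.1 ≠ c p.2

open Classical in
/-- The continuous chromatic number: the least `κ ≤ ℵ₀` for which there is a continuous
coloring with values in `κ` if there is one, and `2^ℵ₀` otherwise. -/
noncomputable def ccn (R : Set (X × X)) : Cardinal.{0} :=
  if ∃ κ ≤ ℵ₀, HasContinuousColoring R κ then sInf {κ | κ ≤ ℵ₀ ∧ HasContinuousColoring R κ}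
  else 2 ^ ℵ₀

/-- `(X, R) ≼ᵢ (Y, S)`: there is an injective continuous homomorphism from `(X, R)` to `(Y, S)`. -/
def InjContLE (R : Set (X × X)) (S : Set (Y × Y)) : Prop :=
  ∃ φ : X → Y, Continuous φ ∧ Function.Injective φ ∧ R ⊆ Prod.map φ φ ⁻¹' S

end Graphs

/-- The space `𝒮_m` of compact digraphs (relations avoiding the diagonal) on `2^ω` with continuous
chromatic number `2` or `3`, as a subspace of the space of compact subsets (the empty set included)
of `2^ω × 2^ω` with the Vietoris topology. -/
abbrev Sm : Type :=
  {K : Compacts (Cantor × Cantor) //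
    Disjoint (K : Set (Cantor × Cantor)) (Set.diagonal Cantor) ∧
      2 ≤ ccn (K : Set (Cantor × Cantor)) ∧ ccn (K : Set (Cantor × Cantor)) ≤ 3}

/-- Bi-embeddability on `𝒮_m`: the equivalence relation associated with `InjContLE`. -/
def BiEmb (K L : Sm) : Prop :=
  InjContLE (K.1 : Set (Cantor × Cantor)) (L.1 : Set (Cantor × Cantor)) ∧
    InjContLE (L.1 : Set (Cantor × Cantor)) (K.1 : Set (Cantor × Cantor))

section Reductions

variable {X Y : Type*} [TopologicalSpace X] [TopologicalSpace Y]

/-- A binary relation on `X` is analytic if it is an analytic subset of `X × X`. -/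
def AnalyticRel (E : X → X → Prop) : Prop :=
  MeasureTheory.AnalyticSet {p : X × X | E p.1 p.2}

/-- `φ` is a reduction of `E` to `F`, that is, `E = (φ × φ)⁻¹(F)`. -/
def IsReduction (φ : X → Y) (E : X → X → Prop) (F : Y → Y → Prop) : Prop :=
  ∀ x y, E x y ↔ F (φ x) (φ y)

/-- `E` is Borel reducible to `F`. -/
def BorelReducible (E : X → X → Prop) (F : Y → Y → Prop) : Prop :=
  ∃ φ : X → Y, @Measurable X Y (borel X) (borel Y) φ ∧ IsReduction φ E F

end Reductions

end CantorGraph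

open Set Topology TopologicalSpace MeasureTheory

/-! An injective homomorphism `φ` from `G_f` to `G_g` sends each edge between `x` and `f x` to an
edge of `G_g`, traversed along `g` or against it. The direction cannot change along an orbit: that
would give `φ (f (f x)) = φ x`, while minimality on an infinite space excludes points of period 2.
So the set of `x` with `φ (f x) = g (φ x)` is closed and `f`-invariant, hence empty or everything.
The range of `φ` is compact and `g`-invariant, hence everything, and `φ` is a flip-conjugacy
(`forall_semiconj_or_forall_reverse`, `flipConjugate_of_injContLE`). Embeddability in one direction
already suffices.

`G_f` lies in `𝒮_m` because a fixed point free homeomorphism can be 3-colored greedily over a finite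
clopen cover (`exists_three_coloring`).

The Polish and analytic claims come from function spaces: homeomorphisms, paired with their
inverses, form a closed set; minimality and injectivity are countable intersections of open
conditions; each relation is the projection of a closed set of witnesses. -/

namespace CantorGraph

/-! ### Polish spaces -/

section PolishSpaces

/-- A `Gδ` subset of a Polish space is Polish. -/
theorem polishSpace_iInter {α : Type*} [TopologicalSpace α] [PolishSpace α] {U : ℕ → Set α}
    (hU : ∀ n, IsOpen (U n)) : PolishSpace (⋂ n, U n : Set α) := by
  have := fun n => (hU n).polishSpace
  -- The diagonal embedding into the product of the `U n`; its range is closed, being the set of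
  -- constant sequences.
  let e : (⋂ n, U n : Set α) → ∀ n, U n := fun x n => ⟨x, mem_iInter.1 x.2 n⟩
  have he : Continuous e := by fun_prop
  have hr : range e = ⋂ n, {p : ∀ n, U n | (p n : α) = p 0} := by
    ext p
    simp only [mem_range, mem_iInter, mem_ofPred_eq]
    constructor
    · rintro ⟨x, rfl⟩ n
      rfl
    · intro hp
      exact ⟨⟨p 0, mem_iInter.2 fun n => hp n ▸ (p n).2⟩, funext fun n => Subtype.ext (hp n).symm⟩
  have hcl : IsClosedEmbedding e := by
    refine ⟨.of_comp he (continuous_subtype_val.comp (continuous_apply 0)) .subtypeVal, ?_⟩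
    rw [hr]
    exact isClosed_iInter fun n => isClosed_eq (by fun_prop) (by fun_prop)
  exact hcl.polishSpace

theorem polishSpace_iInter_of_countable {α ι : Type*} [TopologicalSpace α] [PolishSpace α]
    [Countable ι] {U : ι → Set α} (hU : ∀ i, IsOpen (U i)) : PolishSpace (⋂ i, U i : Set α) := by
  rcases isEmpty_or_nonempty ι with h | h
  · rw [iInter_of_empty]
    exact isClosed_univ.polishSpace
  · obtain ⟨e, he⟩ := exists_surjective_nat ι
    rw [← he.iInter_comp]
    exact polishSpace_iInter fun n => hU _

theorem polishSpace_of_compact {α : Type*} [TopologicalSpace α] [CompactSpace α] [T2Space α]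
    [SecondCountableTopology α] : PolishSpace α := by
  let := metrizableSpaceMetric α
  infer_instance

theorem polishSpace_continuousMap {X Y : Type*} [TopologicalSpace X] [CompactSpace X] [T2Space X]
    [SecondCountableTopology X] [TopologicalSpace Y] [PolishSpace Y] : PolishSpace C(X, Y) := by
  let := upgradeIsCompletelyMetrizable Y
  infer_instance

instance polishSpace_prod {X Y : Type*} [TopologicalSpace X] [TopologicalSpace Y] [PolishSpace X]
    [PolishSpace Y] : PolishSpace (X × Y) :=
  inferInstance

instance compactSpace_cantor : CompactSpace Cantor :=
  inferInstance

instance polishSpace_cantor : PolishSpace Cantor :=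
  polishSpace_of_compact

instance polishSpace_endomorphisms : PolishSpace C(Cantor, Cantor) :=
  polishSpace_continuousMap

instance polishSpace_compacts : PolishSpace (Compacts (Cantor × Cantor)) :=
  polishSpace_of_compact

instance countable_clopens : Countable (Clopens Cantor) :=
  Clopens.countable_iff_secondCountable.2 inferInstance

end PolishSpaces

/-! ### The homeomorphism group and its minimal elements -/

section HomeoGroup

/-- A homeomorphism together with its inverse, as a pair of continuous maps. -/
def toPair (f : Cantor ≃ₜ Cantor) : C(Cantor, Cantor) × C(Cantor, Cantor) :=
  (f, f.symm)

theorem image_eq_iff {X : Type*} [TopologicalSpace X] (f : X ≃ₜ X) (U V : Set X) :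
    f '' U = V ↔ MapsTo f U V ∧ MapsTo f Uᶜ Vᶜ := by
  constructor
  · rintro rfl
    exact ⟨mapsTo_image f U, fun x hx => by simpa using hx⟩
  · rintro ⟨h₁, h₂⟩
    refine h₁.image_subset.antisymm fun y hy => ⟨f.symm y, ?_, by simp⟩
    by_contra h
    exact h₂ h (by simpa using hy)

theorem isOpen_image_eq {U V : Set Cantor} (hU : IsClopen U) (hV : IsClopen V) :
    IsOpen {f : Cantor ≃ₜ Cantor | f '' U = V} :=
  isOpen_generateFrom_of_mem ⟨U, V, hU, hV, rfl⟩

theorem continuous_toContinuousMap :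
    Continuous fun f : Cantor ≃ₜ Cantor => (f : C(Cantor, Cantor)) := by
  rw [ContinuousMap.compactOpen_eq, continuous_generateFrom_iff]
  rintro _ ⟨K, hK, O, hO, rfl⟩
  rw [isOpen_iff_forall_mem_open]
  intro f hf
  -- With `W` clopen between `f '' K` and `O`, the condition `g '' (f ⁻¹' W) = W` is subbasic, holds
  -- at `f`, and forces `g` to map `K` into `O`.
  obtain ⟨W, hW, hKW, hWO⟩ := exists_clopen_of_closed_subset_open
    (hK.image f.continuous).isClosed hO (image_subset_iff.2 hf)
  refine ⟨{g | g '' (f ⁻¹' W) = W}, fun g hg x hx => hWO ?_,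
    isOpen_image_eq (hW.preimage f.continuous) hW, image_preimage_eq _ f.surjective⟩
  rw [← show g '' (f ⁻¹' W) = W from hg]
  exact mem_image_of_mem _ (hKW (mem_image_of_mem f hx))

theorem continuous_symm : Continuous fun f : Cantor ≃ₜ Cantor => f.symm := by
  refine continuous_generateFrom_iff.2 ?_
  rintro _ ⟨U, V, hU, hV, rfl⟩
  convert! isOpen_image_eq hV hU using 1
  ext f
  simp only [mem_preimage, mem_ofPred_eq]
  constructor
  · rintro rfl
    simp [image_image]
  · rintro rfl
    simp [image_image]

theorem continuous_toPair : Continuous toPair :=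
  continuous_toContinuousMap.prodMk (continuous_toContinuousMap.comp continuous_symm)

/-- Recording the inverse makes the range closed: it is cut out by the two equations saying that the
maps are mutually inverse. -/
theorem isClosedEmbedding_toPair : IsClosedEmbedding toPair := by
  have hind : IsInducing toPair := by
    refine ⟨le_antisymm continuous_toPair.le_induced ?_⟩
    refine le_generateFrom ?_
    rintro _ ⟨U, V, hU, hV, rfl⟩
    refine ⟨{p | MapsTo p.1 U V} ∩ {p | MapsTo p.1 Uᶜ Vᶜ}, ?_, ?_⟩
    · exact ((ContinuousMap.isOpen_setOfPred_mapsTo hU.1.isCompact hV.2).preimage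
        continuous_fst).inter ((ContinuousMap.isOpen_setOfPred_mapsTo hU.compl.1.isCompact
        hV.compl.2).preimage continuous_fst)
    · ext f
      exact (image_eq_iff f U V).symm
  have hinj : Function.Injective toPair := fun f g h =>
    Homeomorph.ext fun x => congrArg (fun p => p.1 x) h
  refine ⟨⟨hind, hinj⟩, ?_⟩
  have : range toPair = {p | p.1.comp p.2 = .id _} ∩ {p | p.2.comp p.1 = .id _} := by
    ext ⟨u, v⟩
    constructor
    · rintro ⟨f, hf⟩
      obtain ⟨rfl, rfl⟩ := Prod.mk.inj hf
      exact ⟨ContinuousMap.ext f.apply_symm_apply, ContinuousMap.ext f.symm_apply_apply⟩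
    · rintro ⟨h₁, h₂⟩
      exact ⟨⟨⟨u, v, DFunLike.congr_fun h₂, DFunLike.congr_fun h₁⟩, u.continuous, v.continuous⟩,
        rfl⟩
  rw [this]
  exact (isClosed_eq (continuous_fst.compCM continuous_snd) continuous_const).inter
    (isClosed_eq (continuous_snd.compCM continuous_fst) continuous_const)

instance polishSpace_homeo : PolishSpace (Cantor ≃ₜ Cantor) :=
  isClosedEmbedding_toPair.polishSpace

theorem continuous_eval : Continuous fun p : (Cantor ≃ₜ Cantor) × Cantor => p.1 p.2 :=
  (continuous_toContinuousMap.comp continuous_fst).eval continuous_snd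

theorem continuous_zpow_eval (i : ℤ) :
    Continuous fun p : (Cantor ≃ₜ Cantor) × Cantor => (p.1 ^ i) p.2 := by
  induction i using Int.induction_on with
  | zero => simpa using continuous_snd
  | succ n ih =>
    simp only [zpow_add_one, Homeomorph.mul_apply]
    exact ih.comp (continuous_fst.prodMk continuous_eval)
  | pred n ih =>
    simp only [zpow_sub_one, Homeomorph.mul_apply, Homeomorph.inv_apply]
    exact ih.comp (continuous_fst.prodMk
      (continuous_eval.comp ((continuous_symm.comp continuous_fst).prodMk continuous_snd)))

/-- The complement is the projection, along the compact Cantor space, of a closed set. -/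
theorem isOpen_forall_orbit_meets {U : Set Cantor} (hU : IsOpen U) :
    IsOpen {f : Cantor ≃ₜ Cantor | ∀ x, ∃ i : ℤ, (f ^ i) x ∈ U} := by
  have hW : IsOpen (⋃ i : ℤ, {p : (Cantor ≃ₜ Cantor) × Cantor | (p.1 ^ i) p.2 ∈ U}) :=
    isOpen_iUnion fun i => hU.preimage (continuous_zpow_eval i)
  have := (isClosedMap_fst_of_compactSpace _ hW.isClosed_compl).isOpen_compl
  convert! this using 1
  ext f
  simp

/-- Testing density on the countably many nonempty clopen sets exhibits minimality as a `Gδ`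
condition. -/
theorem isMinimalHomeo_iff (f : Cantor ≃ₜ Cantor) : IsMinimalHomeo f ↔
    ∀ U : {U : Clopens Cantor // U ≠ ⊥}, ∀ x, ∃ i : ℤ, (f ^ i) x ∈ (U.1 : Set Cantor) := by
  constructor
  · rintro hf ⟨U, hU⟩ x
    have hne : (U : Set Cantor).Nonempty := by
      rw [nonempty_iff_ne_empty]
      exact fun h => hU (SetLike.coe_injective h)
    obtain ⟨_, hy, i, rfl⟩ := (hf x).inter_open_nonempty U U.isClopen.2 hne
    exact ⟨i, hy⟩
  · intro h x
    refine dense_iff_inter_open.2 fun O hO ⟨y, hy⟩ => ?_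
    obtain ⟨V, hV, hyV, hVO⟩ := compact_exists_isClopen_in_isOpen hO hy
    obtain ⟨i, hi⟩ := h ⟨⟨V, hV⟩, fun h => by
      have := congrArg (fun W : Clopens Cantor => y ∈ W) h
      exact this.mp hyV⟩ x
    exact ⟨_, hVO hi, i, rfl⟩

instance polishSpace_minimalHomeo : PolishSpace MinimalHomeo := by
  have : {f : Cantor ≃ₜ Cantor | IsMinimalHomeo f} =
      ⋂ U : {U : Clopens Cantor // U ≠ ⊥},
        {f : Cantor ≃ₜ Cantor | ∀ x, ∃ i : ℤ, (f ^ i) x ∈ (U.1 : Set Cantor)} := by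
    ext f
    simp only [mem_ofPred_eq, isMinimalHomeo_iff, mem_iInter]
  have h := polishSpace_iInter_of_countable fun U : {U : Clopens Cantor // U ≠ ⊥} =>
    isOpen_forall_orbit_meets U.1.isClopen.2
  rw [← this] at h
  exact h

end HomeoGroup

/-! ### Continuous chromatic number and the space `𝒮_m` -/

section ChromaticNumber

open Cardinal

variable {X : Type} [TopologicalSpace X]

theorem ccn_le_natCast_iff (R : Set (X × X)) (n : ℕ) :
    ccn R ≤ n ↔ ∃ c : LocallyConstant X (Fin n), ∀ p ∈ R, c p.1 ≠ c p.2 := by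
  constructor
  · intro h
    unfold ccn at h
    split_ifs at h with hR
    · obtain ⟨-, C, c, hC, hc⟩ := csInf_mem (s := {κ | κ ≤ ℵ₀ ∧ HasContinuousColoring R κ}) hR
      rw [← hC, ← Cardinal.mk_fin] at h
      obtain ⟨e⟩ := Cardinal.le_def _ _ |>.1 h
      exact ⟨c.map e, fun p hp heq => hc p hp (e.injective heq)⟩
    -- The default value `2 ^ ℵ₀` exceeds every natural number.
    · exact absurd (h.trans_lt (Cardinal.natCast_lt_aleph0.trans (Cardinal.cantor _))) (lt_irrefl _)
  · rintro ⟨c, hc⟩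
    have hn : (n : Cardinal) ≤ ℵ₀ ∧ HasContinuousColoring R n :=
      ⟨Cardinal.natCast_lt_aleph0.le, Fin n, c, Cardinal.mk_fin n, hc⟩
    unfold ccn
    rw [if_pos ⟨n, hn⟩]
    exact csInf_le' hn

theorem two_le_ccn_iff (R : Set (X × X)) : 2 ≤ ccn R ↔ R.Nonempty := by
  have h₁ : ccn R ≤ (1 : ℕ) ↔ R = ∅ := by
    rw [ccn_le_natCast_iff]
    constructor
    · rintro ⟨c, hc⟩
      exact eq_empty_of_forall_notMem fun p hp => hc p hp (Subsingleton.elim _ _)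
    · rintro rfl
      exact ⟨LocallyConstant.const X 0, by simp⟩
  have h₂ : (2 : Cardinal) = ((1 : ℕ) : Cardinal) + 1 := by
    rw [Nat.cast_one, one_add_one_eq_two]
  rw [nonempty_iff_ne_empty, ne_eq, ← h₁, not_le, h₂, Cardinal.natCast_add_one_le_iff]

theorem ccn_le_three_iff (R : Set (X × X)) :
    ccn R ≤ 3 ↔ ∃ c : LocallyConstant X (Fin 3), ∀ p ∈ R, c p.1 ≠ c p.2 := by
  simpa using ccn_le_natCast_iff R 3

theorem isOpen_colored_by (c : LocallyConstant X (Fin 3)) :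
    IsOpen {K : Compacts (X × X) | ∀ p ∈ (K : Set (X × X)), c p.1 ≠ c p.2} :=
  Compacts.isOpen_subsets_of_isOpen (U := {p : X × X | c p.1 ≠ c p.2}) <|
    (isOpen_discrete {q : Fin 3 × Fin 3 | q.1 ≠ q.2}).preimage
      ((c.continuous.comp continuous_fst).prodMk (c.continuous.comp continuous_snd))

/-- All the conditions are open in the Vietoris topology: avoiding the closed diagonal, being
nonempty, and being colored by some continuous `c`, which for fixed `c` is containment in an open
set. -/
instance polishSpace_sm : PolishSpace Sm := by
  refine IsOpen.polishSpace (α := Compacts (Cantor × Cantor)) (s := {K | _}) ?_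
  have : {K : Compacts (Cantor × Cantor) |
      Disjoint (K : Set (Cantor × Cantor)) (diagonal Cantor) ∧
        2 ≤ ccn (K : Set (Cantor × Cantor)) ∧ ccn (K : Set (Cantor × Cantor)) ≤ 3} =
      {K : Compacts (Cantor × Cantor) | (K : Set (Cantor × Cantor)) ⊆ (diagonal Cantor)ᶜ} ∩
        ({K : Compacts (Cantor × Cantor) | ((K : Set (Cantor × Cantor)) ∩ univ).Nonempty} ∩
          ⋃ c : LocallyConstant Cantor (Fin 3), {K : Compacts (Cantor × Cantor) |
            ∀ p ∈ (K : Set (Cantor × Cantor)), c p.1 ≠ c p.2}) := by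
    ext K
    simp only [two_le_ccn_iff, ccn_le_three_iff, subset_compl_iff_disjoint_right, inter_univ,
      mem_inter_iff, mem_iUnion, mem_ofPred_eq]
  rw [this]
  exact (Compacts.isOpen_subsets_of_isOpen isClosed_diagonal.isOpen_compl).inter
    ((Compacts.isOpen_inter_nonempty_of_isOpen isOpen_univ).inter (isOpen_iUnion isOpen_colored_by))

end ChromaticNumber

/-! ### Greedy 3-coloring -/

section ThreeColoring

/-- A color among `0, 1, 2` that differs from both `a` and `b`. -/
def freshColor (a b : Fin 4) : Fin 4 :=
  if 0 ≠ a ∧ 0 ≠ b then 0 else if 1 ≠ a ∧ 1 ≠ b then 1 else 2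

theorem freshColor_spec : ∀ a b, freshColor a b ≠ 3 ∧ freshColor a b ≠ a ∧ freshColor a b ≠ b := by
  decide

variable {X : Type*} [TopologicalSpace X]

/-- Greedy extension of a partial continuous coloring (`3` means uncolored) along a clopen set
disjoint from its image. -/
theorem exists_extend_coloring (f : X ≃ₜ X) {c : X → Fin 4} (hc : Continuous c)
    (hf : ∀ x, c x ≠ 3 → c x ≠ c (f x)) {V : Set X} (hV : IsClopen V)
    (hVf : ∀ x ∈ V, f x ∉ V) :
    ∃ c' : X → Fin 4, Continuous c' ∧ (∀ x, c' x ≠ 3 → c' x ≠ c' (f x)) ∧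
      (∀ x ∈ V, c' x ≠ 3) ∧ ∀ x, c x ≠ 3 → c' x ≠ 3 := by
  classical
  -- Each point has only the neighbors `f x` and `f.symm x`, so one of three colors is free; no two
  -- newly colored points are adjacent, since `V` misses its image.
  let c' : X → Fin 4 := fun x => if x ∈ V ∧ c x = 3 then freshColor (c (f x)) (c (f.symm x)) else c x
  have hnew : ∀ x, x ∈ V → c x = 3 → c' x = freshColor (c (f x)) (c (f.symm x)) :=
    fun x h₁ h₂ => if_pos ⟨h₁, h₂⟩
  have hold : ∀ x, ¬ (x ∈ V ∧ c x = 3) → c' x = c x := fun x h => if_neg h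
  refine ⟨c', ?_, fun x hx => ?_, fun x hx => ?_, fun x hx => ?_⟩
  · have hcl : IsClopen {x | x ∈ V ∧ c x = 3} := hV.inter ((isClopen_discrete {3}).preimage hc)
    refine Continuous.if (fun x hx => ?_) ?_ hc
    · rw [hcl.frontier_eq] at hx
      exact hx.elim
    · exact (continuous_of_discreteTopology (f := fun p : Fin 4 × Fin 4 => freshColor p.1 p.2)).comp
        ((hc.comp f.continuous).prodMk (hc.comp f.symm.continuous))
  · by_cases h₁ : x ∈ V ∧ c x = 3
    · rw [hnew x h₁.1 h₁.2, hold (f x) fun h => hVf x h₁.1 h.1]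
      exact (freshColor_spec _ _).2.1
    · rw [hold x h₁] at hx ⊢
      by_cases h₂ : f x ∈ V ∧ c (f x) = 3
      · rw [hnew _ h₂.1 h₂.2, f.symm_apply_apply]
        exact (freshColor_spec _ _).2.2.symm
      · rw [hold _ h₂]
        exact hf x hx
  · by_cases h : c x = 3
    · rw [hnew x hx h]
      exact (freshColor_spec _ _).1
    · rwa [hold x fun h' => h h'.2]
  · rwa [hold x fun h => hx h.2]

theorem exists_partial_coloring (f : X ≃ₜ X) {ι : Type*} (s : Finset ι) {V : ι → Set X}
    (hV : ∀ i, IsClopen (V i)) (hVf : ∀ i, ∀ x ∈ V i, f x ∉ V i) :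
    ∃ c : X → Fin 4, Continuous c ∧ (∀ x, c x ≠ 3 → c x ≠ c (f x)) ∧
      ∀ i ∈ s, ∀ x ∈ V i, c x ≠ 3 := by
  classical
  induction s using Finset.induction_on with
  | empty => exact ⟨fun _ => 3, continuous_const, by simp, by simp⟩
  | insert i s _ ih =>
    obtain ⟨c, hc, hf, hs⟩ := ih
    obtain ⟨c', hc', hf', hi, hext⟩ := exists_extend_coloring f hc hf (hV i) (hVf i)
    refine ⟨c', hc', hf', fun j hj x hx => ?_⟩
    rcases Finset.mem_insert.1 hj with rfl | hj
    · exact hi x hx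
    · exact hext x (hs j hj x hx)

/-- A fixed point free homeomorphism of a zero-dimensional compact space has a continuous
`3`-coloring. -/
theorem exists_three_coloring [CompactSpace X] [T2Space X] [TotallyDisconnectedSpace X]
    (f : X ≃ₜ X) (hf : ∀ x, f x ≠ x) :
    ∃ c : LocallyConstant X (Fin 3), ∀ x, c x ≠ c (f x) := by
  have hloc : ∀ x, ∃ V, IsClopen V ∧ x ∈ V ∧ ∀ y ∈ V, f y ∉ V := fun x => by
    obtain ⟨A, B, hA, hB, hxA, hxB, hAB⟩ := t2_separation (hf x).symm
    obtain ⟨V, hV, hxV, hVAB⟩ := compact_exists_isClopen_in_isOpen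
      (hA.inter (hB.preimage f.continuous)) ⟨hxA, hxB⟩
    exact ⟨V, hV, hxV, fun y hy hfy => disjoint_left.1 hAB (hVAB hfy).1 (hVAB hy).2⟩
  choose V hV hxV hVf using hloc
  obtain ⟨s, hs⟩ := isCompact_univ.elim_finite_subcover V (fun x => (hV x).2)
    fun x _ => mem_iUnion.2 ⟨x, hxV x⟩
  obtain ⟨c, hc, hcf, hcs⟩ := exists_partial_coloring f s hV hVf
  have hc3 : ∀ x, c x ≠ 3 := fun x => by
    obtain ⟨i, hi, hxi⟩ := mem_iUnion₂.1 (hs (mem_univ x))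
    exact hcs i hi x hxi
  -- Reduction mod 3 is injective once the marker `3` no longer occurs.
  have hinj : ∀ a b : Fin 4, a ≠ 3 → b ≠ 3 → a ≠ b → Fin.ofNat 3 a ≠ Fin.ofNat 3 b := by decide
  exact ⟨⟨fun x => Fin.ofNat 3 (c x), ((IsLocallyConstant.iff_continuous c).2 hc).comp
    fun a : Fin 4 => Fin.ofNat 3 a⟩, fun x => hinj _ _ (hc3 x) (hc3 (f x)) (hcf x (hc3 x))⟩

end ThreeColoring

/-! ### Equivalence relations -/

section EquivalenceRelations

theorem flipConjugate_symm {X Y : Type*} [TopologicalSpace X] [TopologicalSpace Y] {f : X ≃ₜ X}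
    {g : Y ≃ₜ Y} : FlipConjugate f g → FlipConjugate g f := by
  rintro ⟨φ, h | h⟩
  · refine ⟨φ.symm, .inl (funext fun y => φ.injective ?_)⟩
    have := congrFun h (φ.symm y)
    simp_all
  · refine ⟨φ.symm, .inr (funext fun y => f.injective (φ.injective ?_))⟩
    have := congrFun h (φ.symm (g y))
    simp_all

theorem equivalence_FCO : Equivalence FCO where
  refl f := ⟨.refl _, .inl rfl⟩
  symm := flipConjugate_symm
  trans := by
    rintro f g h ⟨φ, hφ⟩ ⟨ψ, hψ⟩
    -- Passing to inverses in `hψ` covers the case where `φ` flips; two flips cancel.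
    have hψ' : ψ ∘ g.1.symm = h.1.symm ∘ ψ ∨ ψ ∘ g.1.symm = h.1 ∘ ψ := by
      refine hψ.imp (fun hψ => funext fun y => h.1.injective ?_)
        (fun hψ => funext fun y => h.1.symm.injective ?_)
      · have := congrFun hψ (g.1.symm y)
        simp_all
      · have := congrFun hψ (g.1.symm y)
        simp_all
    refine ⟨φ.trans ψ, ?_⟩
    change (ψ ∘ φ) ∘ f.1 = h.1 ∘ ψ ∘ φ ∨ (ψ ∘ φ) ∘ f.1 = h.1.symm ∘ ψ ∘ φ
    rw [Function.comp_assoc]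
    rcases hφ with hφ | hφ
    · rw [hφ, ← Function.comp_assoc]
      exact hψ.imp (fun hψ => by rw [hψ]; rfl) (fun hψ => by rw [hψ]; rfl)
    · rw [hφ, ← Function.comp_assoc]
      exact hψ'.symm.imp (fun hψ => by rw [hψ]; rfl) (fun hψ => by rw [hψ]; rfl)

theorem equivalence_CO : Equivalence CO where
  refl f := ⟨.refl _, rfl⟩
  symm := by
    rintro f g ⟨φ, h⟩
    refine ⟨φ.symm, funext fun y => φ.injective ?_⟩
    have := congrFun h (φ.symm y)
    simp_all
  trans := by
    rintro f g h ⟨φ, hφ⟩ ⟨ψ, hψ⟩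
    refine ⟨φ.trans ψ, ?_⟩
    change (ψ ∘ φ) ∘ f.1 = h.1 ∘ ψ ∘ φ
    rw [Function.comp_assoc, hφ, ← Function.comp_assoc, hψ]
    rfl

theorem injContLE_refl {X : Type} [TopologicalSpace X] (R : Set (X × X)) : InjContLE R R :=
  ⟨id, continuous_id, Function.injective_id, fun _ hp => hp⟩

theorem InjContLE.trans {X Y Z : Type} [TopologicalSpace X] [TopologicalSpace Y]
    [TopologicalSpace Z] {R : Set (X × X)} {S : Set (Y × Y)} {T : Set (Z × Z)} :
    InjContLE R S → InjContLE S T → InjContLE R T := by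
  rintro ⟨φ, hφ, hφi, hRS⟩ ⟨ψ, hψ, hψi, hST⟩
  exact ⟨ψ ∘ φ, hψ.comp hφ, hψi.comp hφi, fun p hp => hST (hRS hp)⟩

theorem equivalence_biEmb : Equivalence BiEmb where
  refl _ := ⟨injContLE_refl _, injContLE_refl _⟩
  symm h := h.symm
  trans h₁ h₂ := ⟨h₁.1.trans h₂.1, h₂.2.trans h₁.2⟩

end EquivalenceRelations

/-! ### Analyticity -/

section Analytic

theorem analyticRel_of_isClosed {X Z : Type*} [TopologicalSpace X] [PolishSpace X]
    [TopologicalSpace Z] [PolishSpace Z] {E : X → X → Prop} {C : Set (Z × X × X)}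
    (hC : IsClosed C) (hE : ∀ x y, E x y ↔ ∃ z, (z, x, y) ∈ C) : AnalyticRel E := by
  have := hC.analyticSet.image_of_continuous continuous_snd
  unfold AnalyticRel
  convert! this using 1
  ext ⟨x, y⟩
  simp [hE]

/-- The continuous self-map underlying a minimal homeomorphism. -/
def toMap (f : MinimalHomeo) : C(Cantor, Cantor) := f.1

theorem continuous_toMap : Continuous toMap :=
  continuous_toContinuousMap.comp continuous_subtype_val

/-- The continuous self-map underlying the inverse of a minimal homeomorphism. -/
def toInvMap (f : MinimalHomeo) : C(Cantor, Cantor) := f.1.symm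

theorem continuous_toInvMap : Continuous toInvMap :=
  continuous_toContinuousMap.comp (continuous_symm.comp continuous_subtype_val)

theorem isClosed_intertwining {h : MinimalHomeo → C(Cantor, Cantor)} (hh : Continuous h) :
    IsClosed {p : (Cantor ≃ₜ Cantor) × MinimalHomeo × MinimalHomeo |
      (p.1 : C(Cantor, Cantor)).comp (toMap p.2.1) = (h p.2.2).comp p.1} := by
  have h₁ : Continuous fun p : (Cantor ≃ₜ Cantor) × MinimalHomeo × MinimalHomeo =>
    (p.1 : C(Cantor, Cantor)) := continuous_toContinuousMap.comp continuous_fst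
  exact isClosed_eq (h₁.compCM (continuous_toMap.comp (continuous_fst.comp continuous_snd)))
    ((hh.comp (continuous_snd.comp continuous_snd)).compCM h₁)

theorem comp_eq_comp_iff (φ : Cantor ≃ₜ Cantor) (u v : C(Cantor, Cantor)) :
    φ ∘ u = v ∘ φ ↔ (φ : C(Cantor, Cantor)).comp u = v.comp φ :=
  ⟨fun h => ContinuousMap.ext (congrFun h), fun h => funext (DFunLike.congr_fun h)⟩

theorem analyticRel_CO : AnalyticRel CO :=
  analyticRel_of_isClosed (isClosed_intertwining continuous_toMap) fun f g =>
    exists_congr fun φ => comp_eq_comp_iff φ (toMap f) (toMap g)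

theorem analyticRel_FCO : AnalyticRel FCO :=
  analyticRel_of_isClosed ((isClosed_intertwining continuous_toMap).union
    (isClosed_intertwining continuous_toInvMap)) fun f g =>
    exists_congr fun φ => or_congr (comp_eq_comp_iff φ (toMap f) (toMap g))
      (comp_eq_comp_iff φ (toMap f) (toInvMap g))

/-- The injective continuous self-maps of the Cantor space. -/
abbrev Injections : Type := {φ : C(Cantor, Cantor) // Function.Injective φ}

/-- The image of a compact set depends continuously on `φ`, and disjointness of compact sets is an
open condition. -/
theorem isOpen_disjoint_image {K L : Set Cantor} (hK : IsCompact K) (hL : IsCompact L) :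
    IsOpen {φ : C(Cantor, Cantor) | Disjoint (φ '' K) (φ '' L)} := by
  have hmap : ∀ K : Compacts Cantor,
      Continuous fun φ : C(Cantor, Cantor) => K.map φ φ.continuous := fun K =>
    Continuous.compacts_map' (g := fun (φ : C(Cantor, Cantor)) x => φ x) continuous_const
      (by fun_prop)
  exact Compacts.isOpen_setOfPred_disjoint_coe.preimage
    ((hmap ⟨K, hK⟩).prodMk (hmap ⟨L, hL⟩))

/-- Clopen sets separate points, so injectivity reduces to countably many conditions, each open in
`φ`. -/
theorem injective_iff_forall_clopens (φ : Cantor → Cantor) : Function.Injective φ ↔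
    ∀ U : Clopens Cantor, Disjoint (φ '' U) (φ '' (U : Set Cantor)ᶜ) := by
  constructor
  · intro h U
    rw [disjoint_image_iff h]
    exact disjoint_compl_right
  · intro h x y hxy
    by_contra hne
    obtain ⟨U, hU, hxU, hUy⟩ := compact_exists_isClopen_in_isOpen (isOpen_compl_singleton (x := y))
      (show x ∈ ({y} : Set Cantor)ᶜ from hne)
    exact disjoint_left.1 (h ⟨U, hU⟩) (mem_image_of_mem φ hxU)
      (hxy ▸ mem_image_of_mem φ fun hy => hUy hy rfl)

instance polishSpace_injections : PolishSpace Injections := by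
  have : {φ : C(Cantor, Cantor) | Function.Injective φ} =
      ⋂ U : Clopens Cantor, {φ : C(Cantor, Cantor) |
        Disjoint (φ '' U) (φ '' (U : Set Cantor)ᶜ)} := by
    ext φ
    simp only [mem_ofPred_eq, injective_iff_forall_clopens, mem_iInter]
  have h := polishSpace_iInter_of_countable fun U : Clopens Cantor =>
    isOpen_disjoint_image U.isClopen.1.isCompact U.isClopen.compl.1.isCompact
  rw [← this] at h
  exact h

/-- Writing inclusion as an equation between continuous expressions makes the set of witnesses
visibly closed. -/
theorem injContLE_iff (K L : Compacts (Cantor × Cantor)) :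
    InjContLE (K : Set (Cantor × Cantor)) (L : Set (Cantor × Cantor)) ↔ ∃ φ : Injections,
      K.map (Prod.map φ.1 φ.1) (φ.1.continuous.prodMap φ.1.continuous) ⊔ L = L := by
  simp only [sup_eq_right]
  constructor
  · rintro ⟨φ, hφ, hφi, h⟩
    exact ⟨⟨⟨φ, hφ⟩, hφi⟩, image_subset_iff.2 h⟩
  · rintro ⟨φ, h⟩
    exact ⟨φ, φ.1.continuous, φ.2, image_subset_iff.1 h⟩

theorem isClosed_homomorphisms :
    IsClosed {p : Injections × Compacts (Cantor × Cantor) × Compacts (Cantor × Cantor) |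
      p.2.1.map (Prod.map p.1.1 p.1.1) (p.1.1.continuous.prodMap p.1.1.continuous) ⊔ p.2.2 =
        p.2.2} := by
  refine isClosed_eq (.sup ?_ ?_) ?_
  · refine Continuous.compacts_map' (g := fun (p : Injections × Compacts (Cantor × Cantor) ×
      Compacts (Cantor × Cantor)) => Prod.map p.1.1 p.1.1)
      (by fun_prop) ?_
    have h : Continuous fun q : Injections × Cantor => q.1.1 q.2 := by fun_prop
    exact (h.comp (by fun_prop : Continuous fun q : (Injections × Compacts (Cantor × Cantor) ×
      Compacts (Cantor × Cantor)) × Cantor × Cantor => (q.1.1, q.2.1))).prodMk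
      (h.comp (by fun_prop : Continuous fun q : (Injections × Compacts (Cantor × Cantor) ×
      Compacts (Cantor × Cantor)) × Cantor × Cantor => (q.1.1, q.2.2)))
  · fun_prop
  · fun_prop

theorem analyticRel_biEmb : AnalyticRel BiEmb := by
  have h₁ : Continuous fun p : (Injections × Injections) × Sm × Sm => (p.1.1, p.2.1.1, p.2.2.1) := by
    fun_prop
  have h₂ : Continuous fun p : (Injections × Injections) × Sm × Sm => (p.1.2, p.2.2.1, p.2.1.1) := by
    fun_prop
  refine analyticRel_of_isClosed ((isClosed_homomorphisms.preimage h₁).inter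
    (isClosed_homomorphisms.preimage h₂)) fun K L => ?_
  unfold BiEmb
  rw [injContLE_iff, injContLE_iff, Prod.exists]
  exact ⟨fun ⟨⟨φ, hφ⟩, ψ, hψ⟩ => ⟨φ, ψ, hφ, hψ⟩, fun ⟨φ, ψ, hφ, hψ⟩ => ⟨⟨φ, hφ⟩, ψ, hψ⟩⟩

end Analytic

/-! ### Rigidity of embeddings between graphs of minimal homeomorphisms -/

section MinimalDynamics

variable {X : Type*} [TopologicalSpace X]

theorem zpow_apply_mem {f : X ≃ₜ X} {S : Set X} (hS : ∀ x, x ∈ S ↔ f x ∈ S) {x : X} (hx : x ∈ S)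
    (i : ℤ) : (f ^ i) x ∈ S := by
  induction i using Int.induction_on with
  | zero => simpa using hx
  | succ n ih =>
    rw [add_comm, zpow_one_add, Homeomorph.mul_apply]
    exact (hS _).1 ih
  | pred n ih =>
    rw [sub_eq_add_neg, add_comm, zpow_add, zpow_neg_one, Homeomorph.mul_apply,
      Homeomorph.inv_apply, hS, f.apply_symm_apply]
    exact ih

theorem IsMinimalHomeo.eq_univ {f : X ≃ₜ X} (hf : IsMinimalHomeo f) {S : Set X} (hc : IsClosed S)
    (hne : S.Nonempty) (hS : ∀ x, x ∈ S ↔ f x ∈ S) : S = univ := by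
  obtain ⟨x, hx⟩ := hne
  refine univ_subset_iff.1 ((hf x).closure_eq ▸ closure_minimal ?_ hc)
  rintro _ ⟨i, rfl⟩
  exact zpow_apply_mem hS hx i

variable [T1Space X] [Infinite X]

/-- Otherwise `{x, f x}` would be a finite, hence closed, invariant set, so all of the infinite
space. -/
theorem IsMinimalHomeo.apply_apply_ne {f : X ≃ₜ X} (hf : IsMinimalHomeo f) (x : X) :
    f (f x) ≠ x := by
  intro h
  have hfin : ({x, f x} : Set X).Finite := toFinite _
  have := hf.eq_univ hfin.isClosed ⟨x, mem_insert _ _⟩ fun y => by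
    have : f y = x ↔ y = f x := by
      constructor
      · intro hy
        exact f.injective (hy.trans h.symm)
      · rintro rfl
        exact h
    simp only [mem_insert_iff, mem_singleton_iff, f.injective.eq_iff, this]
    exact or_comm
  exact infinite_univ (this ▸ hfin)

theorem IsMinimalHomeo.apply_ne {f : X ≃ₜ X} (hf : IsMinimalHomeo f) (x : X) : f x ≠ x :=
  fun h => hf.apply_apply_ne x (by rw [h, h])

theorem mem_inducedGraph {f : X ≃ₜ X} (hf : IsMinimalHomeo f) (p : X × X) :
    p ∈ inducedGraph f ↔ p.2 = f p.1 ∨ p.1 = f p.2 := by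
  obtain ⟨x, y⟩ := p
  simp only [inducedGraph, mem_sdiff, mem_union, mem_ofPred_eq, mem_diagonal_iff,
    and_iff_left_iff_imp]
  rintro (rfl | rfl)
  · exact (hf.apply_ne x).symm
  · exact hf.apply_ne y

/-- An injective homomorphism between the graphs of minimal homeomorphisms respects the direction
of all edges, or reverses the direction of all edges. -/
theorem forall_semiconj_or_forall_reverse {Y : Type*} [TopologicalSpace Y] [T2Space Y]
    {f : X ≃ₜ X} {g : Y ≃ₜ Y} (hf : IsMinimalHomeo f) {φ : X → Y} (hφ : Continuous φ)
    (hinj : Function.Injective φ) (h : ∀ x, φ (f x) = g (φ x) ∨ φ x = g (φ (f x))) :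
    (∀ x, φ (f x) = g (φ x)) ∨ ∀ x, φ x = g (φ (f x)) := by
  let S : Set X := {x | φ (f x) = g (φ x)}
  have hS : ∀ x, x ∈ S ↔ f x ∈ S := by
    intro x
    constructor
    · intro hx
      -- A reversal at `f x` would make `g (φ (f (f x)))` and `g (φ x)` both equal to `φ (f x)`.
      refine (h (f x)).resolve_right fun h' => hf.apply_apply_ne x ?_
      exact (hinj (g.injective (h'.symm.trans hx)))
    · intro hx
      refine (h x).resolve_right fun h' => hf.apply_apply_ne x ?_
      exact hinj (Eq.trans hx h'.symm)
  rcases S.eq_empty_or_nonempty with hemp | hne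
  · exact .inr fun x => (h x).resolve_left fun hx => (hemp ▸ hx : x ∈ (∅ : Set X))
  · have hu : S = univ := hf.eq_univ (isClosed_eq (hφ.comp f.continuous) (g.continuous.comp hφ)) hne hS
    exact .inl fun x => (hu ▸ mem_univ x : x ∈ S)

theorem flipConjugate_of_injContLE {X Y : Type} [TopologicalSpace X] [TopologicalSpace Y]
    [CompactSpace X] [T1Space X] [Infinite X] [T2Space Y] [Infinite Y] {f : X ≃ₜ X} {g : Y ≃ₜ Y}
    (hf : IsMinimalHomeo f) (hg : IsMinimalHomeo g)
    (h : InjContLE (inducedGraph f) (inducedGraph g)) : FlipConjugate f g := by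
  obtain ⟨φ, hφ, hinj, hhom⟩ := h
  have hdir := forall_semiconj_or_forall_reverse hf hφ hinj fun x =>
    (mem_inducedGraph hg (φ x, φ (f x))).1
      (hhom (show (x, f x) ∈ inducedGraph f from (mem_inducedGraph hf _).2 (.inl rfl)))
  -- In either direction the compact range is invariant under `g` and its inverse, so minimality of
  -- `g` gives surjectivity.
  have hrange : range φ = univ := by
    obtain ⟨x₀⟩ : Nonempty X := inferInstance
    refine hg.eq_univ (isCompact_range hφ).isClosed ⟨φ x₀, mem_range_self _⟩ fun y => ?_
    rcases hdir with hdir | hdir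
    · constructor
      · rintro ⟨x, rfl⟩
        exact ⟨f x, hdir x⟩
      · rintro ⟨x, hx⟩
        refine ⟨f.symm x, g.injective ?_⟩
        rw [← hdir, f.apply_symm_apply, hx]
    · constructor
      · rintro ⟨x, rfl⟩
        exact ⟨f.symm x, by rw [hdir, f.apply_symm_apply]⟩
      · rintro ⟨x, hx⟩
        exact ⟨f x, g.injective (by rw [← hdir, hx])⟩
  let e : X ≃ Y := .ofBijective φ ⟨hinj, range_eq_univ.1 hrange⟩
  have he : Continuous e := hφ
  refine ⟨he.homeoOfEquivCompactToT2, hdir.imp (fun hdir => funext hdir) fun hdir => ?_⟩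
  refine funext fun x => g.injective ?_
  exact (hdir x).symm.trans (g.apply_symm_apply _).symm

theorem injContLE_of_flipConjugate {X Y : Type} [TopologicalSpace X] [TopologicalSpace Y]
    {f : X ≃ₜ X} {g : Y ≃ₜ Y} (h : FlipConjugate f g) :
    InjContLE (inducedGraph f) (inducedGraph g) := by
  obtain ⟨φ, hφ⟩ := h
  refine ⟨φ, φ.continuous, φ.injective, ?_⟩
  rintro ⟨x, y⟩ ⟨hxy, hne⟩
  refine ⟨?_, fun h => hne (φ.injective h)⟩
  have hxy : y = f x ∨ x = f y := hxy
  rcases hφ with hφ | hφ <;> rcases hxy with rfl | rfl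
  · exact .inl (congrFun hφ x)
  · exact .inr (congrFun hφ y)
  · exact .inr ((g.symm_apply_eq.1 (congrFun hφ x).symm))
  · exact .inl ((g.symm_apply_eq.1 (congrFun hφ y).symm))

end MinimalDynamics

/-! ### The reduction `f ↦ G_f` -/

section Reduction

/-- The graph `G_f` of a minimal homeomorphism, as a compact set. -/
def compactGraph (f : MinimalHomeo) : Compacts (Cantor × Cantor) :=
  (⊤ : Compacts Cantor).map (fun x => (x, toMap f x)) (by fun_prop) ⊔
    (⊤ : Compacts Cantor).map (fun x => (toMap f x, x)) (by fun_prop)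

theorem coe_compactGraph (f : MinimalHomeo) :
    (compactGraph f : Set (Cantor × Cantor)) = inducedGraph f.1 := by
  ext ⟨x, y⟩
  rw [mem_inducedGraph f.2]
  simp [compactGraph, toMap, eq_comm]

theorem continuous_compactGraph : Continuous compactGraph := by
  have h : Continuous fun p : MinimalHomeo × Cantor => toMap p.1 p.2 :=
    (continuous_toMap.comp continuous_fst).eval continuous_snd
  exact .sup (.compacts_map' (g := fun f x => (x, toMap f x)) continuous_const
    (continuous_snd.prodMk h)) (.compacts_map' (g := fun f x => (toMap f x, x)) continuous_const
    (h.prodMk continuous_snd))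

/-- The map `f ↦ (2^ω, G_f)` from `𝕄` to `𝒮_m`. -/
def toSm (f : MinimalHomeo) : Sm := by
  refine ⟨compactGraph f, ?_⟩
  rw [coe_compactGraph, two_le_ccn_iff, ccn_le_three_iff]
  refine ⟨disjoint_sdiff_left, ⟨(default, f.1 default), (mem_inducedGraph f.2 _).2 (.inl rfl)⟩, ?_⟩
  obtain ⟨c, hc⟩ := exists_three_coloring f.1 f.2.apply_ne
  refine ⟨c, fun p hp => ?_⟩
  rcases (mem_inducedGraph f.2 p).1 hp with h | h
  · rw [h]
    exact hc _
  · rw [h]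
    exact (hc _).symm

theorem coe_toSm (f : MinimalHomeo) :
    ((toSm f).1 : Set (Cantor × Cantor)) = inducedGraph f.1 :=
  coe_compactGraph f

theorem continuous_toSm : Continuous toSm :=
  continuous_compactGraph.subtype_mk _

theorem isReduction_toSm : IsReduction toSm FCO BiEmb := by
  intro f g
  unfold BiEmb
  rw [coe_toSm, coe_toSm]
  exact ⟨fun h => ⟨injContLE_of_flipConjugate h, injContLE_of_flipConjugate (flipConjugate_symm h)⟩,
    fun h => flipConjugate_of_injContLE f.2 g.2 h.1⟩

theorem borelReducible_FCO_biEmb : BorelReducible FCO BiEmb := by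
  borelize MinimalHomeo Sm
  exact ⟨toSm, continuous_toSm.measurable, isReduction_toSm⟩

end Reduction

end CantorGraph

theorem theorem1p17 :
    (PolishSpace CantorGraph.MinimalHomeo ∧ PolishSpace CantorGraph.Sm) ∧
    (Equivalence CantorGraph.FCO ∧ Equivalence CantorGraph.CO ∧ Equivalence CantorGraph.BiEmb) ∧
    (CantorGraph.AnalyticRel CantorGraph.FCO ∧ CantorGraph.AnalyticRel CantorGraph.CO ∧
      CantorGraph.AnalyticRel CantorGraph.BiEmb) ∧
    CantorGraph.BorelReducible CantorGraph.FCO CantorGraph.BiEmb ∧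
    ∃ g : CantorGraph.MinimalHomeo → CantorGraph.Sm,
      (∀ f : CantorGraph.MinimalHomeo,
        ((g f).1 : Set (CantorGraph.Cantor × CantorGraph.Cantor)) =
          CantorGraph.inducedGraph f.1) ∧
      Continuous g ∧ CantorGraph.IsReduction g CantorGraph.FCO CantorGraph.BiEmb :=
  ⟨⟨CantorGraph.polishSpace_minimalHomeo, CantorGraph.polishSpace_sm⟩,
    ⟨CantorGraph.equivalence_FCO, CantorGraph.equivalence_CO, CantorGraph.equivalence_biEmb⟩,
    ⟨CantorGraph.analyticRel_FCO, CantorGraph.analyticRel_CO, CantorGraph.analyticRel_biEmb⟩,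
    CantorGraph.borelReducible_FCO_biEmb, CantorGraph.toSm, CantorGraph.coe_toSm,
    CantorGraph.continuous_toSm, CantorGraph.isReduction_toSm⟩
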